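/- **Theorem 3.** Let $\Omega=[a,b]^\nu\subset\mathbb R^\nu$ with Lebesgue measure, let $k:\Omega^3\to\mathbb C$ be continuous, and let $T_1$ be the bounded partial integral operator on $\mathcal H=L_2(\Omega\times\Omega)$ given by $$(T_1f)(x,y)=\int_\Omega k(x,s,y)f(s,y)\,ds .$$ For $y\in\Omega$ and $\varkappa\in\mathbb C$ let $D_1(y;\varkappa)$ and $M_1(x,s,y;\varkappa)$ be the Fredholm determinant and the Fredholm minor of $E-\varkappa K_y$, where $E$ is the identity and $(K_y\varphi)(x)=\int_\Omega k(x,s,y)\varphi(s)\,ds$ on $L_2(\Omega)$: $$D_1(y;\varkappa)=\sum_{n=0}^\infty\frac{(-\varkappa)^n}{n!}\int_{\Omega^n}\det\big(k(t_i,t_j,y)\big)_{i,j=1}^n\,dt_1\cdots dt_n ,$$ $$M_1(x,s,y;\varkappa)=\sum_{n=0}^\infty\frac{(-\varkappa)^n}{n!}\int_{\Omega^n}\det\big(k(u_i,v_j,y)\big)_{i,j=0}^n\,dt_1\cdots dt_n ,$$ where $u_0=x$, $v_0=s$ and $u_i=v_i=t_i$ for $1\le i\le n$; the terms with $n=0$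 are $1$ and $k(x,s,y)$ respectively. Suppose that $\varkappa_0\in\mathbb C$ is a regular number, that is, $D_1(y;\varkappa_0)\neq0$ for every $y\in\Omega$. Then the formula $$(Bg)(x,y)=\int_\Omega\frac{M_1(x,s,y;\varkappa_0)}{D_1(y;\varkappa_0)}\,g(s,y)\,ds$$ defines a bounded linear operator $B$ on $\mathcal H$, and for every $g_0\in\mathcal H$ the equation $f-\varkappa_0T_1f=g_0$ has a unique solution $f\in\mathcal H$, namely $f=g_0+\varkappa_0Bg_0$. In particular, the homogeneous equation $f-\varkappa_0T_1f=0$ has only the zero solution. -/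

import Mathlib

open MeasureTheory
open scoped ENNReal

/-- The cube `Ω = [a,b]^ν`, as a subspace of `ℝ^ν`. It carries the Lebesgue measure `volume`. -/
abbrev Cube (ν : ℕ) (a b : ℝ) : Type :=
  ↥(Set.Icc (fun _ : Fin ν => a) (fun _ : Fin ν => b))

noncomputable instance Cube.measureSpace (ν : ℕ) (a b : ℝ) : MeasureSpace (Cube ν a b) :=
  Measure.Subtype.measureSpace

instance Cube.isFiniteMeasure (ν : ℕ) (a b : ℝ) :
    IsFiniteMeasure (volume : Measure (Cube ν a b)) := by
  refine ⟨?_⟩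
  rw [Measure.Subtype.volume_univ measurableSet_Icc.nullMeasurableSet]
  exact isCompact_Icc.measure_lt_top

/-- The complex Hilbert space `L₂(Ω × Ω)` with respect to the product Lebesgue measure. -/
abbrev L2Space (ν : ℕ) (a b : ℝ) : Type :=
  Lp ℂ 2 (volume : Measure (Cube ν a b × Cube ν a b))

section Operator

variable {ν : ℕ} {a b : ℝ}

/-- The function `(x, y) ↦ ∫_Ω k(x,s,y) g(s,y) ds`. -/
noncomputable def partialIntegral (k : Cube ν a b → Cube ν a b → Cube ν a b → ℂ)
    (g : Cube ν a b × Cube ν a b → ℂ) : Cube ν a b × Cube ν a b → ℂ :=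
  fun p => ∫ s, k p.1 s p.2 * g (s, p.2)

/-- The bounded operator `A` on `L₂(Ω × Ω)` is the partial integral operator with kernel `k`:
for every `g` and almost every `(x,y)`, the function `s ↦ k(x,s,y) g(s,y)` is integrable on `Ω`
and `(A g)(x,y) = ∫_Ω k(x,s,y) g(s,y) ds`. -/
def IsPartialIntegralOperator (k : Cube ν a b → Cube ν a b → Cube ν a b → ℂ)
    (A : L2Space ν a b →L[ℂ] L2Space ν a b) : Prop :=
  ∀ g : L2Space ν a b, ∀ᵐ p : Cube ν a b × Cube ν a b,
    Integrable (fun s => k p.1 s p.2 * g (s, p.2)) ∧ A g p = partialIntegral k g p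

/-- A continuous kernel on `Ω³` as a function of three variables `x, s, y`. -/
noncomputable def kernelFun (k : C(Cube ν a b × Cube ν a b × Cube ν a b, ℂ)) :
    Cube ν a b → Cube ν a b → Cube ν a b → ℂ :=
  fun x s y => k (x, s, y)

theorem ae_slice {P : Cube ν a b × Cube ν a b → Prop} (h : ∀ᵐ p, P p) :
    ∀ᵐ p : Cube ν a b × Cube ν a b, ∀ᵐ s : Cube ν a b, P (s, p.2) := by
  have h1 : ∀ᵐ q : Cube ν a b × Cube ν a b, P q.swap :=
    Measure.measurePreserving_swap.quasiMeasurePreserving.ae h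
  exact Measure.quasiMeasurePreserving_snd.ae (Measure.ae_ae_of_ae_prod h1)

theorem integrable_slice (k : C(Cube ν a b × Cube ν a b × Cube ν a b, ℂ))
    (g : L2Space ν a b) : ∀ᵐ p : Cube ν a b × Cube ν a b,
      Integrable (fun s => kernelFun k p.1 s p.2 * g (s, p.2)) := by
  have h1 : Integrable (g : Cube ν a b × Cube ν a b → ℂ) :=
    (Lp.memLp g).integrable (by norm_num)
  have h2 : ∀ᵐ p : Cube ν a b × Cube ν a b, Integrable (fun s => g (s, p.2)) :=
    Measure.quasiMeasurePreserving_snd.ae (h1.prod_left_ae)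
  filter_upwards [h2] with p hp
  refine hp.bdd_mul (c := ‖k‖) ?_ ?_
  · exact Continuous.aestronglyMeasurable (by unfold kernelFun; fun_prop)
  · exact Filter.Eventually.of_forall fun s => k.norm_coe_le_norm _

theorem partialIntegral_stronglyMeasurable (k : C(Cube ν a b × Cube ν a b × Cube ν a b, ℂ))
    (g : L2Space ν a b) : StronglyMeasurable (partialIntegral (kernelFun k) g) := by
  unfold partialIntegral
  refine StronglyMeasurable.integral_prod_right
    (f := fun (p : Cube ν a b × Cube ν a b) s => kernelFun k p.1 s p.2 * g (s, p.2)) ?_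
  refine StronglyMeasurable.mul ?_ ?_
  · exact Continuous.stronglyMeasurable (by unfold kernelFun; fun_prop)
  · exact (Lp.stronglyMeasurable g).comp_measurable (by fun_prop)

theorem partialIntegral_enorm_sq_le (k : C(Cube ν a b × Cube ν a b × Cube ν a b, ℂ))
    (g : L2Space ν a b) (p : Cube ν a b × Cube ν a b) :
    ‖partialIntegral (kernelFun k) g p‖ₑ ^ (2 : ℝ) ≤
      ‖k‖ₑ ^ (2 : ℝ) * (volume (Set.univ : Set (Cube ν a b)) *
        ∫⁻ s, ‖g (s, p.2)‖ₑ ^ (2 : ℝ)) := by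
  have h1 : ‖partialIntegral (kernelFun k) g p‖ₑ ≤ ‖k‖ₑ * ∫⁻ s, 1 * ‖g (s, p.2)‖ₑ := by
    refine (enorm_integral_le_lintegral_enorm _).trans ?_
    rw [← lintegral_const_mul' _ _ enorm_ne_top]
    refine lintegral_mono fun s => ?_
    simp only [enorm_mul, one_mul]
    gcongr
    exact enorm_le_iff_norm_le.2 (k.norm_coe_le_norm _)
  have hm : AEMeasurable (fun s => ‖g (s, p.2)‖ₑ) :=
    ((Lp.stronglyMeasurable g).comp_measurable
      (g := fun s : Cube ν a b => (s, p.2)) (by fun_prop)).enorm.aemeasurable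
  have h2 := ENNReal.lintegral_mul_le_Lp_mul_Lq (volume : Measure (Cube ν a b))
    (p := 2) (q := 2) Real.HolderConjugate.two_two
    (f := fun _ => 1) (g := fun s => ‖g (s, p.2)‖ₑ) aemeasurable_const hm
  have h3 := h1.trans (mul_le_mul_right h2 _)
  refine (ENNReal.rpow_le_rpow h3 (by norm_num : (0 : ℝ) ≤ 2)).trans (le_of_eq ?_)
  rw [ENNReal.mul_rpow_of_nonneg _ _ (by norm_num), ENNReal.mul_rpow_of_nonneg _ _ (by norm_num),
    ← ENNReal.rpow_mul, ← ENNReal.rpow_mul]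
  simp

theorem partialIntegral_eLpNorm_le (k : C(Cube ν a b × Cube ν a b × Cube ν a b, ℂ))
    (g : L2Space ν a b) :
    eLpNorm (partialIntegral (kernelFun k) g) 2 volume ≤
      ‖k‖ₑ * volume (Set.univ : Set (Cube ν a b)) * eLpNorm g 2 volume := by
  rw [eLpNorm_eq_lintegral_rpow_enorm_toReal (by norm_num) (by norm_num),
    eLpNorm_eq_lintegral_rpow_enorm_toReal (by norm_num) (by norm_num)]
  simp only [ENNReal.toReal_ofNat]
  have hm : Measurable fun q : Cube ν a b × Cube ν a b => ‖g q‖ₑ ^ (2 : ℝ) :=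
    (Lp.stronglyMeasurable g).enorm.pow_const _
  have key : ∫⁻ p, ‖partialIntegral (kernelFun k) g p‖ₑ ^ (2 : ℝ) ≤
      (‖k‖ₑ * volume (Set.univ : Set (Cube ν a b))) ^ (2 : ℝ) * ∫⁻ q, ‖g q‖ₑ ^ (2 : ℝ) := by
    refine (lintegral_mono (partialIntegral_enorm_sq_le k g)).trans (le_of_eq ?_)
    have hm2 : Measurable fun y : Cube ν a b => ∫⁻ s, ‖g (s, y)‖ₑ ^ (2 : ℝ) :=
      hm.lintegral_prod_left'
    have hm3 : Measurable fun p : Cube ν a b × Cube ν a b =>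
        ∫⁻ s, ‖g (s, p.2)‖ₑ ^ (2 : ℝ) := hm2.comp measurable_snd
    have e1 : ∫⁻ p : Cube ν a b × Cube ν a b, ∫⁻ s, ‖g (s, p.2)‖ₑ ^ (2 : ℝ) =
        ∫⁻ _x : Cube ν a b, ∫⁻ y : Cube ν a b, ∫⁻ s, ‖g (s, y)‖ₑ ^ (2 : ℝ) :=
      lintegral_prod _ hm3.aemeasurable
    have e2 : ∫⁻ q, ‖g q‖ₑ ^ (2 : ℝ) =
        ∫⁻ y : Cube ν a b, ∫⁻ s : Cube ν a b, ‖g (s, y)‖ₑ ^ (2 : ℝ) :=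
      lintegral_prod_symm _ hm.aemeasurable
    rw [lintegral_const_mul _ (hm3.const_mul _), lintegral_const_mul _ hm3,
      ENNReal.mul_rpow_of_nonneg _ _ (by norm_num), e1, e2]
    simp only [lintegral_const]
    rw [ENNReal.rpow_two (volume _)]
    ring
  refine (ENNReal.rpow_le_rpow key (by norm_num)).trans (le_of_eq ?_)
  rw [ENNReal.mul_rpow_of_nonneg _ _ (by norm_num), ← ENNReal.rpow_mul]
  simp

theorem partialIntegral_memLp (k : C(Cube ν a b × Cube ν a b × Cube ν a b, ℂ))
    (g : L2Space ν a b) : MemLp (partialIntegral (kernelFun k) g) 2 volume :=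
  ⟨(partialIntegral_stronglyMeasurable k g).aestronglyMeasurable,
    (partialIntegral_eLpNorm_le k g).trans_lt
      (ENNReal.mul_lt_top (ENNReal.mul_lt_top enorm_lt_top (measure_lt_top _ _))
        (Lp.eLpNorm_lt_top g))⟩

/-- The partial integral operator `T₁` with continuous kernel `k`, as a bounded operator on
`L₂(Ω × Ω)`: `(T₁ f)(x,y) = ∫_Ω k(x,s,y) f(s,y) ds`. -/
noncomputable def partialIntegralOperator (k : C(Cube ν a b × Cube ν a b × Cube ν a b, ℂ)) :
    L2Space ν a b →L[ℂ] L2Space ν a b :=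
  LinearMap.mkContinuous
    { toFun := fun f => (partialIntegral_memLp k f).toLp (partialIntegral (kernelFun k) f)
      map_add' := by
        intro f g
        rw [← MemLp.toLp_add, MemLp.toLp_eq_toLp_iff]
        filter_upwards [ae_slice (Lp.coeFn_add f g), integrable_slice k f,
          integrable_slice k g] with p h hf hg
        simp only [partialIntegral, Pi.add_apply]
        rw [← integral_add hf hg]
        refine integral_congr_ae ?_
        filter_upwards [h] with s hs
        rw [hs, Pi.add_apply, mul_add]
      map_smul' := by
        intro c f
        rw [RingHom.id_apply, ← MemLp.toLp_const_smul, MemLp.toLp_eq_toLp_iff]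
        filter_upwards [ae_slice (Lp.coeFn_smul c f)] with p h
        simp only [partialIntegral, Pi.smul_apply, smul_eq_mul]
        rw [← integral_const_mul]
        refine integral_congr_ae ?_
        filter_upwards [h] with s hs
        rw [hs, Pi.smul_apply, smul_eq_mul]
        ring }
    (‖k‖ * (volume (Set.univ : Set (Cube ν a b))).toReal)
    (by
      intro f
      change ‖(partialIntegral_memLp k f).toLp (partialIntegral (kernelFun k) f)‖ ≤ _
      rw [Lp.norm_toLp, Lp.norm_def]
      have h := ENNReal.toReal_mono
        (ENNReal.mul_lt_top (ENNReal.mul_lt_top enorm_lt_top (measure_lt_top _ _))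
          (Lp.eLpNorm_lt_top f)).ne (partialIntegral_eLpNorm_le k f)
      simpa using h)

/-- The operator just constructed is given by the integral formula. -/
theorem isPartialIntegralOperator_partialIntegralOperator
    (k : C(Cube ν a b × Cube ν a b × Cube ν a b, ℂ)) :
    IsPartialIntegralOperator (kernelFun k) (partialIntegralOperator k) := fun g =>
  (integrable_slice k g).and (MemLp.coeFn_toLp (partialIntegral_memLp k g))

end Operator

section Fredholm

variable {X : Type*} [MeasureSpace X]

/-- The Fredholm determinant of `E - ϰ K`, where `(K φ)(x) = ∫ K(x,s) φ(s) ds`: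
`Δ(ϰ) = ∑_{n ≥ 0} (-ϰ)ⁿ / n! ∫ ⋯ ∫ det (K(tᵢ,tⱼ))_{1 ≤ i,j ≤ n} dt₁ ⋯ dtₙ`
(the term `n = 0` is `1`). -/
noncomputable def fredholmDet (K : X → X → ℂ) (ϰ : ℂ) : ℂ :=
  ∑' n : ℕ, (-ϰ) ^ n / (n.factorial : ℂ) *
    ∫ t : Fin n → X, (Matrix.of fun i j => K (t i) (t j)).det

/-- The Fredholm minor of `E - ϰ K`:
`M(x,s;ϰ) = ∑_{n ≥ 0} (-ϰ)ⁿ / n! ∫ ⋯ ∫ det (K(uᵢ,vⱼ))_{0 ≤ i,j ≤ n} dt₁ ⋯ dtₙ`,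
where `u = (x, t₁, …, tₙ)` and `v = (s, t₁, …, tₙ)` (the term `n = 0` is `K(x,s)`). -/
noncomputable def fredholmMinor (K : X → X → ℂ) (ϰ : ℂ) (x s : X) : ℂ :=
  ∑' n : ℕ, (-ϰ) ^ n / (n.factorial : ℂ) *
    ∫ t : Fin n → X,
      (Matrix.of fun i j : Fin (n + 1) =>
        K ((Fin.cons x t : Fin (n + 1) → X) i) ((Fin.cons s t : Fin (n + 1) → X) j)).det

end Fredholm

section Determinant

variable {ν : ℕ} {a b : ℝ}

/-- The determinant `D₁(y;ϰ)` of `E - ϰ T₁`: the Fredholm determinant of `E - ϰ K_y`, where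
`K_y` is the integral operator on `L₂(Ω)` with kernel `(x,s) ↦ k(x,s,y)`. -/
noncomputable def pieDet (k : C(Cube ν a b × Cube ν a b × Cube ν a b, ℂ))
    (y : Cube ν a b) (ϰ : ℂ) : ℂ :=
  fredholmDet (fun x s => k (x, s, y)) ϰ

/-- The minor `M₁(x,s,y;ϰ)` of `E - ϰ T₁`: the Fredholm minor of `E - ϰ K_y`. -/
noncomputable def pieMinor (k : C(Cube ν a b × Cube ν a b × Cube ν a b, ℂ))
    (x s y : Cube ν a b) (ϰ : ℂ) : ℂ :=
  fredholmMinor (fun x s => k (x, s, y)) ϰ x s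

/-- The set of regular numbers of the equation `f - ϰ T₁ f = g₀`. -/
def regularNumbers (k : C(Cube ν a b × Cube ν a b × Cube ν a b, ℂ)) : Set ℂ :=
  {ϰ | ∀ y : Cube ν a b, pieDet k y ϰ ≠ 0}

end Determinant

/-! For fixed `y` this is Fredholm's theory of `E - ϰK_y`. Hadamard's inequality makes both series
converge with bounds that depend on the kernel only through its supremum, so convergence is uniform
in all variables and the determinant and minor are continuous. Expanding the minor's determinant
along its first row and integrating (`fredholmMinorCoeff_succ`) gives a recursion between
coefficients, which sums to `M = K D + ϰ K M`; transposing the kernel gives `M = K D + ϰ M K`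
(products in the second term being compositions).

At a regular number the nowhere vanishing `D` can be divided out. The kernel `M / D` is then
continuous on the compact `Ω³`, hence defines a bounded operator `B`, and Fubini
(`partialIntegralOperator_eq_add_comp`) turns the two identities into `B = T + ϰTB` and `B = T +
ϰBT`. The first makes `g + ϰBg` a solution, the second makes it the only one. -/

/-! ### Hadamard's inequality and summability of the majorants -/

open scoped ComplexOrder in
/-- Hadamard's bound for the determinant of a complex matrix with bounded entries. -/
theorem norm_det_sq_le {n : ℕ} (A : Matrix (Fin n) (Fin n) ℂ) {c : ℝ}
    (h : ∀ i j, ‖A i j‖ ≤ c) : ‖A.det‖ ^ 2 ≤ (n * c ^ 2) ^ n := by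
  rcases Nat.eq_zero_or_pos n with rfl | hn
  · simp
  have hP : (A.conjTranspose * A).PosSemidef := Matrix.posSemidef_conjTranspose_mul_self A
  set e := hP.isHermitian.eigenvalues with he
  have he0 : ∀ i, 0 ≤ e i := hP.eigenvalues_nonneg
  have hdet : ‖A.det‖ ^ 2 = ∏ i, e i := by
    have h1 := hP.isHermitian.det_eq_prod_eigenvalues
    rw [Matrix.det_mul, Matrix.det_conjTranspose, Complex.star_def, Complex.conj_mul'] at h1
    exact Complex.ofReal_injective (by push_cast; exact h1)
  have htr : ∑ i, e i = ∑ i, ∑ j, ‖A j i‖ ^ 2 := by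
    have h1 := hP.isHermitian.trace_eq_sum_eigenvalues
    have h2 : (A.conjTranspose * A).trace = ((∑ i, ∑ j, ‖A j i‖ ^ 2 : ℝ) : ℂ) := by
      simp [Matrix.trace, Matrix.mul_apply, Complex.conj_mul']
    rw [h2] at h1
    exact Complex.ofReal_injective ((by push_cast; rfl : _ = _).trans h1.symm)
  have hsum : ∑ i, e i ≤ n * (n * c ^ 2) := by
    rw [htr]
    calc ∑ i, ∑ j, ‖A j i‖ ^ 2 ≤ ∑ _i : Fin n, ∑ _j : Fin n, c ^ 2 :=
          Finset.sum_le_sum fun i _ => Finset.sum_le_sum fun j _ =>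
            pow_le_pow_left₀ (norm_nonneg _) (h j i) 2
      _ = n * (n * c ^ 2) := by simp
  have hn' : (0 : ℝ) < n := by exact_mod_cast hn
  -- AM-GM with equal weights `1/n` on the eigenvalues of `Aᴴ A`: their product is `‖det A‖²`, and
  -- their sum is the squared Frobenius norm, at most `n² c²`.
  have hamgm := Real.geom_mean_le_arith_mean_weighted Finset.univ (fun _ : Fin n => (n : ℝ)⁻¹) e
    (fun _ _ => by positivity) (by simp [hn'.ne']) (fun i _ => he0 i)
  have hpow := pow_le_pow_left₀ (Finset.prod_nonneg fun i _ => Real.rpow_nonneg (he0 i) _) hamgm n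
  rw [← Finset.prod_pow, ← Finset.mul_sum] at hpow
  have h3 : ∀ i, (e i ^ ((n : ℝ)⁻¹)) ^ n = e i := fun i => Real.rpow_inv_natCast_pow (he0 i) hn.ne'
  simp only [h3] at hpow
  rw [hdet]
  refine hpow.trans (pow_le_pow_left₀ ?_ ?_ n)
  · exact mul_nonneg (by positivity) (Finset.sum_nonneg fun i _ => he0 i)
  · rw [inv_mul_le_iff₀ hn']
    exact hsum

theorem norm_det_le {n : ℕ} (A : Matrix (Fin n) (Fin n) ℂ) {c : ℝ}
    (h : ∀ i j, ‖A i j‖ ≤ c) : ‖A.det‖ ≤ √((n * c ^ 2) ^ n) :=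
  Real.le_sqrt_of_sq_le (norm_det_sq_le A h)

/-- Since `m ^ m ≤ e ^ m * m!`, the square root grows like `√(n!)` up to exponential factors, and
the factorial in the denominator wins. -/
theorem summable_hadamard_succ (q c : ℝ) :
    Summable fun n : ℕ => q ^ n / n.factorial * √((((n + 1 : ℕ) : ℝ) * c ^ 2) ^ (n + 1)) := by
  obtain ⟨d, hd⟩ : ∃ d, d = Real.exp 1 * c ^ 2 := ⟨_, rfl⟩
  have hd0 : 0 ≤ d := by rw [hd]; positivity
  -- The square root is removed by `|t| ≤ 4⁻ⁿ + 4ⁿ t²`: squaring `t` leaves one factorial in the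
  -- denominator, hence an exponential series. In `8 = 4 * 2`, the `4` comes from this inequality
  -- and the `2` from `n + 1 ≤ 2 ^ n`.
  have hs : Summable fun n : ℕ => (1 / 4 : ℝ) ^ n + d * ((8 * q ^ 2 * d) ^ n / n.factorial) :=
    (summable_geometric_of_lt_one (by norm_num) (by norm_num)).add
      ((Real.summable_pow_div_factorial _).mul_left _)
  refine Summable.of_norm_bounded hs fun n => ?_
  have hf : (0 : ℝ) < n.factorial := by exact_mod_cast n.factorial_pos
  set A := (((n + 1 : ℕ) : ℝ) * c ^ 2) ^ (n + 1) with hA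
  have hA0 : 0 ≤ A := by positivity
  have hle : A ≤ (n + 1) * n.factorial * d ^ (n + 1) := by
    have h1 := Real.pow_div_factorial_le_exp ((n + 1 : ℕ) : ℝ) (by positivity) (n + 1)
    rw [div_le_iff₀ (by positivity)] at h1
    rw [hA, mul_pow, hd, mul_pow, ← Real.exp_nat_mul, mul_one]
    have h2 : (((n + 1).factorial : ℕ) : ℝ) = (n + 1) * n.factorial := by
      rw [Nat.factorial_succ]; push_cast; ring
    rw [h2] at h1
    calc _ ≤ (Real.exp ((n + 1 : ℕ) : ℝ) * ((n + 1) * n.factorial)) * (c ^ 2) ^ (n + 1) := by gcongr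
      _ = _ := by ring
  have hn2 : ((n : ℝ) + 1) ≤ 2 ^ n := by
    exact_mod_cast Nat.lt_two_pow_self
  have hsq : (q ^ n / n.factorial * √A) ^ 2 ≤ (q ^ 2) ^ n * (2 ^ n * d ^ (n + 1) / n.factorial) := by
    rw [mul_pow, Real.sq_sqrt hA0]
    calc (q ^ n / n.factorial) ^ 2 * A
        ≤ (q ^ n / n.factorial) ^ 2 * (2 ^ n * n.factorial * d ^ (n + 1)) := by
          gcongr
          exact hle.trans (by gcongr)
      _ = _ := by field_simp; ring
  have key : |q ^ n / n.factorial * √A| ≤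
      (1 / 4) ^ n + 4 ^ n * (q ^ n / n.factorial * √A) ^ 2 := by
    set t := q ^ n / n.factorial * √A
    have h4 : (1 / 4 : ℝ) ^ n * 4 ^ n = 1 := by rw [← mul_pow]; norm_num
    have e1 : (1 / 4 : ℝ) ^ n = (1 / 2 : ℝ) ^ n * (1 / 2) ^ n := by rw [← mul_pow]; norm_num
    have e2 : (4 : ℝ) ^ n = 2 ^ n * 2 ^ n := by rw [← mul_pow]; norm_num
    have e3 : (1 / 2 : ℝ) ^ n * 2 ^ n = 1 := by rw [← mul_pow]; norm_num
    rw [← sq_abs t, e1, e2]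
    have hu : 0 ≤ |t| := abs_nonneg t
    have h5 : ((1 / 2 : ℝ) ^ n) * (2 ^ n * |t|) = |t| := by rw [← mul_assoc, e3, one_mul]
    nlinarith [sq_nonneg ((1 / 2 : ℝ) ^ n - 2 ^ n * |t|)]
  rw [Real.norm_eq_abs]
  refine key.trans (add_le_add_right ?_ _)
  calc (4 : ℝ) ^ n * (q ^ n / n.factorial * √A) ^ 2
      ≤ 4 ^ n * ((q ^ 2) ^ n * (2 ^ n * d ^ (n + 1) / n.factorial)) := by gcongr
    _ = d * ((8 * q ^ 2 * d) ^ n / n.factorial) := by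
      rw [show (8 : ℝ) = 4 * 2 by norm_num, mul_pow _ d, mul_pow _ (q ^ 2), mul_pow 4]; ring

theorem summable_hadamard (q c : ℝ) :
    Summable fun n : ℕ => q ^ n / n.factorial * √(((n : ℝ) * c ^ 2) ^ n) := by
  rw [← summable_nat_add_iff 1]
  refine Summable.of_norm_bounded ((summable_hadamard_succ |q| c).mul_left |q|) fun n => ?_
  rw [norm_mul, Real.norm_eq_abs, Real.norm_eq_abs, abs_of_nonneg (Real.sqrt_nonneg _), ← mul_assoc]
  refine mul_le_mul_of_nonneg_right ?_ (Real.sqrt_nonneg _)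
  rw [abs_div, abs_pow, Nat.abs_cast, ← mul_div_assoc, ← pow_succ']
  gcongr
  exact n.le_succ

theorem continuous_cons_apply {Z X : Type*} [TopologicalSpace Z] [TopologicalSpace X] {n : ℕ}
    {z : Z → X} {w : Z → Fin n → X} (hz : Continuous z) (hw : Continuous w) (l : Fin (n + 1)) :
    Continuous fun q : Z => (Fin.cons (z q) (w q) : Fin (n + 1) → X) l := by
  cases l using Fin.cases with
  | zero => exact hz
  | succ l => exact (continuous_apply l).comp hw

/-! ### Convergence and continuity of the Fredholm series -/

section FredholmSeries

variable {X : Type*} [MeasureSpace X]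

/-- The coefficient `∫ ⋯ ∫ det (K(tᵢ,tⱼ)) dt₁ ⋯ dtₙ` of the Fredholm determinant. -/
noncomputable def fredholmDetCoeff (K : X → X → ℂ) (n : ℕ) : ℂ :=
  ∫ t : Fin n → X, (Matrix.of fun i j => K (t i) (t j)).det

/-- The coefficient of the Fredholm minor. -/
noncomputable def fredholmMinorCoeff (K : X → X → ℂ) (n : ℕ) (x s : X) : ℂ :=
  ∫ t : Fin n → X,
    (Matrix.of fun i j : Fin (n + 1) =>
      K ((Fin.cons x t : Fin (n + 1) → X) i) ((Fin.cons s t : Fin (n + 1) → X) j)).det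

theorem fredholmDetCoeff_zero [SigmaFinite (volume : Measure X)] (K : X → X → ℂ) :
    fredholmDetCoeff K 0 = 1 := by
  simp [fredholmDetCoeff, measureReal_def, volume_pi]

theorem fredholmMinorCoeff_zero [SigmaFinite (volume : Measure X)] (K : X → X → ℂ) (x s : X) :
    fredholmMinorCoeff K 0 x s = K x s := by
  simp [fredholmMinorCoeff, measureReal_def, volume_pi]

/-- Transposing the kernel transposes the matrix. This symmetry later yields the second Fredholm
identity from the first. -/
theorem fredholmDetCoeff_swap (K : X → X → ℂ) (n : ℕ) :
    fredholmDetCoeff (fun x s => K s x) n = fredholmDetCoeff K n := by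
  unfold fredholmDetCoeff
  congr 1 with t
  rw [← Matrix.det_transpose]
  rfl

theorem fredholmMinorCoeff_swap (K : X → X → ℂ) (n : ℕ) (x s : X) :
    fredholmMinorCoeff (fun x s => K s x) n x s = fredholmMinorCoeff K n s x := by
  unfold fredholmMinorCoeff
  congr 1 with t
  rw [← Matrix.det_transpose]
  rfl

theorem fredholmDet_swap (K : X → X → ℂ) (ϰ : ℂ) :
    fredholmDet (fun x s => K s x) ϰ = fredholmDet K ϰ :=
  tsum_congr fun n => congrArg _ (fredholmDetCoeff_swap K n)

theorem fredholmMinor_swap (K : X → X → ℂ) (ϰ : ℂ) (x s : X) :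
    fredholmMinor (fun x s => K s x) ϰ x s = fredholmMinor K ϰ s x :=
  tsum_congr fun n => congrArg _ (fredholmMinorCoeff_swap K n x s)

variable [IsFiniteMeasure (volume : Measure X)]

theorem measureReal_pi_univ (n : ℕ) :
    (volume : Measure (Fin n → X)).real Set.univ = (volume : Measure X).real Set.univ ^ n := by
  simp [measureReal_def, volume_pi, Measure.pi_univ]

/-- The bound sees the kernel only through `c`, so it serves as a Weierstrass majorant uniformly
over a family of kernels. -/
theorem norm_fredholmDetTerm_le {K : X → X → ℂ} {c : ℝ} (hc : ∀ x s, ‖K x s‖ ≤ c) (ϰ : ℂ)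
    (n : ℕ) :
    ‖(-ϰ) ^ n / (n.factorial : ℂ) * fredholmDetCoeff K n‖ ≤
      (‖ϰ‖ * (volume : Measure X).real Set.univ) ^ n / n.factorial * √(((n : ℝ) * c ^ 2) ^ n) := by
  have h : ‖fredholmDetCoeff K n‖ ≤ √(((n : ℝ) * c ^ 2) ^ n) * (volume : Measure X).real Set.univ ^ n := by
    rw [← measureReal_pi_univ]
    exact norm_integral_le_of_norm_le_const
      (Filter.Eventually.of_forall fun t => norm_det_le _ fun i j => hc _ _)
  rw [norm_mul, norm_div, norm_pow, norm_neg, Complex.norm_natCast]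
  calc _ ≤ ‖ϰ‖ ^ n / n.factorial * (√(((n : ℝ) * c ^ 2) ^ n) * (volume : Measure X).real Set.univ ^ n) := by
        gcongr
    _ = _ := by rw [mul_pow]; ring

theorem norm_fredholmMinorTerm_le {K : X → X → ℂ} {c : ℝ} (hc : ∀ x s, ‖K x s‖ ≤ c) (ϰ : ℂ)
    (n : ℕ) (x s : X) :
    ‖(-ϰ) ^ n / (n.factorial : ℂ) * fredholmMinorCoeff K n x s‖ ≤
      (‖ϰ‖ * (volume : Measure X).real Set.univ) ^ n / n.factorial *
        √((((n + 1 : ℕ) : ℝ) * c ^ 2) ^ (n + 1)) := by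
  have h : ‖fredholmMinorCoeff K n x s‖ ≤
      √((((n + 1 : ℕ) : ℝ) * c ^ 2) ^ (n + 1)) * (volume : Measure X).real Set.univ ^ n := by
    rw [← measureReal_pi_univ]
    exact norm_integral_le_of_norm_le_const
      (Filter.Eventually.of_forall fun t => norm_det_le _ fun i j => hc _ _)
  rw [norm_mul, norm_div, norm_pow, norm_neg, Complex.norm_natCast]
  calc _ ≤ ‖ϰ‖ ^ n / n.factorial *
        (√((((n + 1 : ℕ) : ℝ) * c ^ 2) ^ (n + 1)) * (volume : Measure X).real Set.univ ^ n) := by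
        gcongr
    _ = _ := by rw [mul_pow]; ring

theorem hasSum_fredholmDet {K : X → X → ℂ} {c : ℝ} (hc : ∀ x s, ‖K x s‖ ≤ c) (ϰ : ℂ) :
    HasSum (fun n : ℕ => (-ϰ) ^ n / (n.factorial : ℂ) * fredholmDetCoeff K n)
      (fredholmDet K ϰ) :=
  (Summable.of_norm_bounded (summable_hadamard _ c) (norm_fredholmDetTerm_le hc ϰ)).hasSum

theorem hasSum_fredholmMinor {K : X → X → ℂ} {c : ℝ} (hc : ∀ x s, ‖K x s‖ ≤ c) (ϰ : ℂ)
    (x s : X) :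
    HasSum (fun n : ℕ => (-ϰ) ^ n / (n.factorial : ℂ) * fredholmMinorCoeff K n x s)
      (fredholmMinor K ϰ x s) :=
  (Summable.of_norm_bounded (summable_hadamard_succ _ c)
    fun n => norm_fredholmMinorTerm_le hc ϰ n x s).hasSum

variable [TopologicalSpace X] [SecondCountableTopology X] [BorelSpace X]
variable {P : Type*} [TopologicalSpace P] [FirstCountableTopology P]

/-- Each coefficient is continuous in the parameter by dominated convergence, and the M-test passes
this to the sum. -/
theorem continuous_fredholmDet {K : P → X → X → ℂ}
    (hK : Continuous fun q : P × X × X => K q.1 q.2.1 q.2.2) {c : ℝ}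
    (hc : ∀ p x s, ‖K p x s‖ ≤ c) (ϰ : ℂ) :
    Continuous fun p => fredholmDet (K p) ϰ := by
  refine continuous_tsum (fun n => ?_) (summable_hadamard _ c)
    fun n p => norm_fredholmDetTerm_le (hc p) ϰ n
  refine continuous_const.mul ?_
  have hcont : Continuous fun q : P × (Fin n → X) =>
      (Matrix.of fun i j => K q.1 (q.2 i) (q.2 j)).det := by
    refine Continuous.matrix_det (continuous_matrix fun i j => ?_)
    exact hK.comp (f := fun q : P × (Fin n → X) => (q.1, q.2 i, q.2 j)) (by fun_prop)
  refine continuous_of_dominated (bound := fun _ => √(((n : ℝ) * c ^ 2) ^ n))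
    (fun p => ?_) (fun p => ?_) (integrable_const _) ?_
  · exact (hcont.comp (Continuous.prodMk_right p)).aestronglyMeasurable
  · exact Filter.Eventually.of_forall fun t => norm_det_le _ fun i j => hc _ _ _
  · exact Filter.Eventually.of_forall fun t => hcont.comp (Continuous.prodMk_left t)

theorem continuous_fredholmMinorCoeff {K : P → X → X → ℂ}
    (hK : Continuous fun q : P × X × X => K q.1 q.2.1 q.2.2) {c : ℝ}
    (hc : ∀ p x s, ‖K p x s‖ ≤ c) (n : ℕ) {x s : P → X} (hx : Continuous x) (hs : Continuous s) :
    Continuous fun p => fredholmMinorCoeff (K p) n (x p) (s p) := by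
  have hcont : Continuous fun q : P × (Fin n → X) =>
      (Matrix.of fun i j : Fin (n + 1) => K q.1 ((Fin.cons (x q.1) q.2 : Fin (n + 1) → X) i)
        ((Fin.cons (s q.1) q.2 : Fin (n + 1) → X) j)).det := by
    refine Continuous.matrix_det (continuous_matrix fun i j => ?_)
    exact hK.comp (continuous_fst.prodMk 
      ((continuous_cons_apply (hx.comp continuous_fst) continuous_snd i).prodMk
        (continuous_cons_apply (hs.comp continuous_fst) continuous_snd j)))
  refine continuous_of_dominated (bound := fun _ => √((((n + 1 : ℕ) : ℝ) * c ^ 2) ^ (n + 1)))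
    (fun p => ?_) (fun p => ?_) (integrable_const _) ?_
  · exact (hcont.comp (Continuous.prodMk_right p)).aestronglyMeasurable
  · exact Filter.Eventually.of_forall fun t => norm_det_le _ fun i j => hc _ _ _
  · exact Filter.Eventually.of_forall fun t => hcont.comp (Continuous.prodMk_left t)

theorem continuous_fredholmMinor {K : P → X → X → ℂ}
    (hK : Continuous fun q : P × X × X => K q.1 q.2.1 q.2.2) {c : ℝ}
    (hc : ∀ p x s, ‖K p x s‖ ≤ c) (ϰ : ℂ) {x s : P → X} (hx : Continuous x) (hs : Continuous s) :
    Continuous fun p => fredholmMinor (K p) ϰ (x p) (s p) :=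
  continuous_tsum
    (fun n => continuous_const.mul (continuous_fredholmMinorCoeff hK hc n hx hs))
    (summable_hadamard_succ _ c) fun n p => norm_fredholmMinorTerm_le (hc p) ϰ n (x p) (s p)

/-! ### The Fredholm identities -/

/-- Laplace expansion of the determinant in the Fredholm minor along the row of `x`. -/
theorem det_cons_cons_succ {R Z : Type*} [CommRing R] (K : Z → Z → R) (n : ℕ) (x s : Z)
    (t : Fin (n + 1) → Z) :
    (Matrix.of fun i j : Fin (n + 2) =>
      K ((Fin.cons x t : Fin (n + 2) → Z) i) ((Fin.cons s t : Fin (n + 2) → Z) j)).det =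
    K x s * (Matrix.of fun i j => K (t i) (t j)).det -
      ∑ l : Fin (n + 1), K x (t l) *
        (Matrix.of fun i j : Fin (n + 1) =>
          K ((Fin.cons (t l) (l.removeNth t) : Fin (n + 1) → Z) i)
            ((Fin.cons s (l.removeNth t) : Fin (n + 1) → Z) j)).det := by
  rw [Matrix.det_succ_row_zero, Fin.sum_univ_succ, sub_eq_add_neg, ← Finset.sum_neg_distrib]
  congr 1
  · simp only [Fin.val_zero, pow_zero, one_mul, Matrix.of_apply, Fin.cons_zero]
    congr 1
  · refine Finset.sum_congr rfl fun l _ => ?_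
    -- Moving row `t l` to the front is a cycle of sign `(-1) ^ l`; against the cofactor sign `(-1)
    -- ^ (l + 1)` this leaves `-1` for every `l`.
    have hperm : (Matrix.of fun i j : Fin (n + 1) =>
          K ((Fin.cons (t l) (l.removeNth t) : Fin (n + 1) → Z) i)
            ((Fin.cons s (l.removeNth t) : Fin (n + 1) → Z) j)) =
        (Matrix.of fun i j : Fin (n + 1) =>
          K (t i) ((Fin.cons s (l.removeNth t) : Fin (n + 1) → Z) j)).submatrix
            l.cycleRange.symm id := by
      ext i j
      rw [Fin.cons_removeNth_eq_comp_cycleRange_symm]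
      rfl
    have hminor : (Matrix.of fun i j : Fin (n + 2) =>
          K ((Fin.cons x t : Fin (n + 2) → Z) i)
            ((Fin.cons s t : Fin (n + 2) → Z) j)).submatrix Fin.succ l.succ.succAbove =
        (Matrix.of fun i j : Fin (n + 1) =>
          K (t i) ((Fin.cons s (l.removeNth t) : Fin (n + 1) → Z) j)) := by
      ext i j
      cases j using Fin.cases <;> simp [Fin.removeNth]
    rw [hperm, hminor, Matrix.det_permute, Equiv.Perm.sign_symm, Fin.sign_cycleRange]
    simp only [Matrix.of_apply, Fin.cons_zero, Fin.cons_succ, Fin.val_succ]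
    push_cast
    ring

variable [CompactSpace X]

theorem Continuous.integrable_of_compactSpace {Z : Type*} [TopologicalSpace Z] [CompactSpace Z]
    [MeasurableSpace Z] [OpensMeasurableSpace Z] {μ : Measure Z} [IsFiniteMeasure μ]
    {f : Z → ℂ} (hf : Continuous f) : Integrable f μ :=
  hf.integrable_of_hasCompactSupport (HasCompactSupport.of_compactSpace f)

/-- In the integrated Laplace expansion, singling out `t l` as `τ` and relabelling the other
variables gives the same integral for every `l`, whence the factor `n + 1`. -/
theorem fredholmMinorCoeff_succ {K : X → X → ℂ} (hK : Continuous fun q : X × X => K q.1 q.2)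
    (n : ℕ) (x s : X) :
    fredholmMinorCoeff K (n + 1) x s =
      K x s * fredholmDetCoeff K (n + 1) - (n + 1) * ∫ τ, K x τ * fredholmMinorCoeff K n τ s := by
  let G : X × (Fin n → X) → ℂ := fun q => K x q.1 *
    (Matrix.of fun i j : Fin (n + 1) => K ((Fin.cons q.1 q.2 : Fin (n + 1) → X) i)
      ((Fin.cons s q.2 : Fin (n + 1) → X) j)).det
  have hG : Continuous G := by
    refine (hK.comp (continuous_const.prodMk continuous_fst)).mul
      (Continuous.matrix_det (continuous_matrix fun i j => ?_))
    exact hK.comp ((continuous_cons_apply continuous_fst continuous_snd i).prodMk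
      (continuous_cons_apply continuous_const continuous_snd j))
  have hD : Continuous fun t : Fin (n + 1) → X => (Matrix.of fun i j => K (t i) (t j)).det := by
    refine Continuous.matrix_det (continuous_matrix fun i j => ?_)
    exact hK.comp (f := fun t : Fin (n + 1) → X => (t i, t j))
      ((continuous_apply i).prodMk (continuous_apply j))
  have hGl : ∀ l : Fin (n + 1), ∫ t : Fin (n + 1) → X, G (t l, l.removeNth t) =
      ∫ τ, K x τ * fredholmMinorCoeff K n τ s := by
    intro l
    have h1 := (volume_preserving_piFinSuccAbove (fun _ : Fin (n + 1) => X) l).integral_comp' G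
    refine h1.trans ?_
    rw [Measure.volume_eq_prod, integral_prod _ hG.integrable_of_compactSpace]
    congr 1 with τ
    exact integral_const_mul (K x τ) _
  have hGi : ∀ l : Fin (n + 1),
      Integrable fun t : Fin (n + 1) → X => G (t l, l.removeNth t) := fun l =>
    (hG.comp ((continuous_apply l).prodMk
      (continuous_pi fun i => continuous_apply (l.succAbove i)))).integrable_of_compactSpace
  unfold fredholmMinorCoeff
  simp only [det_cons_cons_succ]
  change ∫ t : Fin (n + 1) → X, (K x s * (Matrix.of fun i j => K (t i) (t j)).det -
    ∑ l, G (t l, l.removeNth t)) = _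
  rw [integral_sub (hD.integrable_of_compactSpace.const_mul _)
    (integrable_finsetSum _ fun l _ => hGi l), integral_finsetSum _ fun l _ => hGi l,
    integral_const_mul]
  simp only [hGl, Finset.sum_const, Finset.card_univ, Fintype.card_fin, nsmul_eq_mul]
  push_cast
  rfl

/-- The first Fredholm identity. -/
theorem fredholmMinor_eq_left {K : X → X → ℂ} (hK : Continuous fun q : X × X => K q.1 q.2)
    {c : ℝ} (hc : ∀ x s, ‖K x s‖ ≤ c) (ϰ : ℂ) (x s : X) :
    fredholmMinor K ϰ x s = K x s * fredholmDet K ϰ + ϰ * ∫ t, K x t * fredholmMinor K ϰ t s := by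
  -- The factor `n + 1` of the recursion cancels against `(n + 1)!`, and its minus sign turns `-ϰ`
  -- into `ϰ`.
  have hterm : ∀ n : ℕ, (-ϰ) ^ (n + 1) / ((n + 1).factorial : ℂ) * (n + 1) =
      -ϰ * ((-ϰ) ^ n / (n.factorial : ℂ)) := by
    intro n
    have hf : (n.factorial : ℂ) ≠ 0 := by exact_mod_cast n.factorial_ne_zero
    have hn : (n : ℂ) + 1 ≠ 0 := by exact_mod_cast n.succ_ne_zero
    rw [Nat.factorial_succ]
    push_cast
    field_simp
    ring
  have hint : HasSum (fun n : ℕ => (-ϰ) ^ n / (n.factorial : ℂ) *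
      ∫ t, K x t * fredholmMinorCoeff K n t s) (∫ t, K x t * fredholmMinor K ϰ t s) := by
    have hmeas : ∀ n, Continuous fun t => fredholmMinorCoeff K n t s := fun n =>
      continuous_fredholmMinorCoeff (K := fun _ : X => K) (hK.comp continuous_snd)
        (fun _ => hc) n continuous_id continuous_const
    have hsum := summable_hadamard_succ (‖ϰ‖ * (volume : Measure X).real Set.univ) c
    have h := hasSum_integral_of_dominated_convergence (μ := (volume : Measure X))
      (F := fun n t => (-ϰ) ^ n / (n.factorial : ℂ) * (K x t * fredholmMinorCoeff K n t s))
      (f := fun t => K x t * fredholmMinor K ϰ t s)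
      (bound := fun n _ => c * ((‖ϰ‖ * (volume : Measure X).real Set.univ) ^ n / n.factorial *
        √((((n + 1 : ℕ) : ℝ) * c ^ 2) ^ (n + 1))))
      (fun n => (continuous_const.mul ((hK.comp (Continuous.prodMk_right x)).mul
        (hmeas n))).aestronglyMeasurable)
      (fun n => Filter.Eventually.of_forall fun t => ?_)
      (Filter.Eventually.of_forall fun _ => hsum.mul_left c) (integrable_const _)
      (Filter.Eventually.of_forall fun t => ?_)
    · simpa only [integral_const_mul] using h
    · rw [mul_left_comm, norm_mul]
      have hc0 : 0 ≤ c := (norm_nonneg _).trans (hc x t)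
      exact mul_le_mul (hc x t) (norm_fredholmMinorTerm_le hc ϰ n t s) (norm_nonneg _) hc0
    · simpa only [mul_left_comm] using (hasSum_fredholmMinor hc ϰ t s).mul_left (K x t)
  -- The recursion only covers indices from `1` on. The dropped terms match: `K x s` in the minor,
  -- and `K x s * 1` from the determinant.
  have h1 := (hasSum_nat_add_iff' 1).2 (hasSum_fredholmMinor hc ϰ x s)
  have h2 := (((hasSum_nat_add_iff' 1).2 (hasSum_fredholmDet hc ϰ)).mul_left (K x s)).add
    (hint.mul_left ϰ)
  simp only [Finset.range_one, Finset.sum_singleton, pow_zero, Nat.factorial_zero, Nat.cast_one,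
    div_one, one_mul, fredholmDetCoeff_zero, fredholmMinorCoeff_zero] at h1 h2
  have h3 := h1.unique (h2.congr_fun ?_)
  · linear_combination h3
  · intro n
    rw [fredholmMinorCoeff_succ hK]
    linear_combination -(∫ t, K x t * fredholmMinorCoeff K n t s) * hterm n

/-- The second Fredholm identity. -/
theorem fredholmMinor_eq_right {K : X → X → ℂ} (hK : Continuous fun q : X × X => K q.1 q.2)
    {c : ℝ} (hc : ∀ x s, ‖K x s‖ ≤ c) (ϰ : ℂ) (x s : X) :
    fredholmMinor K ϰ x s = K x s * fredholmDet K ϰ + ϰ * ∫ t, fredholmMinor K ϰ x t * K t s := by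
  have h := fredholmMinor_eq_left (K := fun x s => K s x) (hK.comp continuous_swap)
    (fun x s => hc s x) ϰ s x
  simp only [fredholmMinor_swap, fredholmDet_swap] at h
  simpa only [mul_comm (K _ s)] using h

end FredholmSeries

/-! ### The resolvent kernel and composition of operators -/

section Resolvent

variable {ν : ℕ} {a b : ℝ}

/-- Composition of partial integral operators with continuous kernels. -/
theorem partialIntegralOperator_eq_add_comp
    {r k₁ k₂ k₃ : C(Cube ν a b × Cube ν a b × Cube ν a b, ℂ)} {ϰ : ℂ}
    (h : ∀ x s y, r (x, s, y) = k₁ (x, s, y) + ϰ * ∫ t, k₂ (x, t, y) * k₃ (t, s, y)) :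
    partialIntegralOperator r = partialIntegralOperator k₁ +
      ϰ • (partialIntegralOperator k₂).comp (partialIntegralOperator k₃) := by
  ext g : 1
  apply Lp.ext
  have hg : ∀ᵐ p : Cube ν a b × Cube ν a b, Integrable (fun s => g (s, p.2)) :=
    Measure.quasiMeasurePreserving_snd.ae
      (((Lp.memLp g).integrable (by norm_num)).prod_left_ae)
  have h3 := isPartialIntegralOperator_partialIntegralOperator k₃ g
  filter_upwards [isPartialIntegralOperator_partialIntegralOperator r g,
    isPartialIntegralOperator_partialIntegralOperator k₁ g,
    isPartialIntegralOperator_partialIntegralOperator k₂ (partialIntegralOperator k₃ g),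
    -- The integral formula for the inner operator holds only almost everywhere on `Ω × Ω`; slicing
    -- makes it usable under the outer integral, for almost every `t` at the given `y`.
    ae_slice h3, hg,
    Lp.coeFn_add (partialIntegralOperator k₁ g)
      (ϰ • (partialIntegralOperator k₂ (partialIntegralOperator k₃ g))),
    Lp.coeFn_smul ϰ (partialIntegralOperator k₂ (partialIntegralOperator k₃ g))]
    with p hr h1 h2 h3 hg hadd hsmul
  obtain ⟨x, y⟩ := p
  -- Fubini's hypothesis: the kernels are bounded, and almost every slice of `g` is integrable
  -- because `L₂ ⊆ L₁` on a finite measure space.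
  have hprod : Integrable (fun q : Cube ν a b × Cube ν a b =>
      k₂ (x, q.1, y) * k₃ (q.1, q.2, y) * g (q.2, y)) (volume.prod volume) := by
    refine (hg.comp_snd volume).bdd_mul (c := ‖k₂‖ * ‖k₃‖) ?_ ?_
    · exact Continuous.aestronglyMeasurable (by fun_prop)
    · refine Filter.Eventually.of_forall fun q => ?_
      rw [norm_mul]
      exact mul_le_mul (k₂.norm_coe_le_norm _) (k₃.norm_coe_le_norm _) (norm_nonneg _)
        (norm_nonneg _)
  have e2 : partialIntegral (kernelFun k₂) (partialIntegralOperator k₃ g) (x, y) =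
      ∫ s, (∫ t, k₂ (x, t, y) * k₃ (t, s, y)) * g (s, y) := by
    calc partialIntegral (kernelFun k₂) (partialIntegralOperator k₃ g) (x, y)
        = ∫ t, ∫ s, k₂ (x, t, y) * k₃ (t, s, y) * g (s, y) := by
          refine integral_congr_ae ?_
          filter_upwards [h3] with t ht
          simp only [ht.2, partialIntegral, kernelFun, mul_assoc]
          exact (integral_const_mul _ _).symm
      _ = ∫ s, ∫ t, k₂ (x, t, y) * k₃ (t, s, y) * g (s, y) := integral_integral_swap hprod
      _ = _ := by simp only [integral_mul_const]
  have hi : Integrable fun s => (∫ t, k₂ (x, t, y) * k₃ (t, s, y)) * g (s, y) := by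
    simpa only [integral_mul_const] using hprod.integral_prod_right
  change partialIntegralOperator r g (x, y) = (partialIntegralOperator k₁ g +
      ϰ • (partialIntegralOperator k₂ (partialIntegralOperator k₃ g)) : L2Space ν a b) (x, y)
  rw [hadd, Pi.add_apply, hsmul, Pi.smul_apply, smul_eq_mul, hr.2, h1.2, h2.2, e2,
    ← integral_const_mul]
  simp only [partialIntegral]
  rw [← integral_add h1.1 (hi.const_mul ϰ)]
  congr 1 with s
  simp only [kernelFun, h]
  ring

variable (k : C(Cube ν a b × Cube ν a b × Cube ν a b, ℂ))

theorem continuous_slice (y : Cube ν a b) :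
    Continuous fun q : Cube ν a b × Cube ν a b => k (q.1, q.2, y) := by fun_prop

theorem pieMinor_eq_left (x s y : Cube ν a b) (ϰ : ℂ) :
    pieMinor k x s y ϰ = k (x, s, y) * pieDet k y ϰ + ϰ * ∫ t, k (x, t, y) * pieMinor k t s y ϰ :=
  fredholmMinor_eq_left (K := fun x s => k (x, s, y)) (continuous_slice k y)
    (fun _ _ => k.norm_coe_le_norm _) ϰ x s

theorem pieMinor_eq_right (x s y : Cube ν a b) (ϰ : ℂ) :
    pieMinor k x s y ϰ = k (x, s, y) * pieDet k y ϰ + ϰ * ∫ t, pieMinor k x t y ϰ * k (t, s, y) :=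
  fredholmMinor_eq_right (K := fun x s => k (x, s, y)) (continuous_slice k y)
    (fun _ _ => k.norm_coe_le_norm _) ϰ x s

theorem continuous_pieDet (ϰ : ℂ) : Continuous fun y => pieDet k y ϰ :=
  continuous_fredholmDet (K := fun y x s => k (x, s, y)) (by fun_prop)
    (fun _ _ _ => k.norm_coe_le_norm _) ϰ

theorem continuous_pieMinor (ϰ : ℂ) : Continuous fun p : Cube ν a b × Cube ν a b × Cube ν a b =>
    pieMinor k p.1 p.2.1 p.2.2 ϰ :=
  continuous_fredholmMinor
    (K := fun (p : Cube ν a b × Cube ν a b × Cube ν a b) x s => k (x, s, p.2.2))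
    (by fun_prop) (fun _ _ _ => k.norm_coe_le_norm _) ϰ continuous_fst
    (continuous_fst.comp continuous_snd)

variable {k}

/-- The resolvent kernel `M₁ / D₁` at a regular number. -/
noncomputable def resolventKernel {ϰ : ℂ} (hϰ : ϰ ∈ regularNumbers k) :
    C(Cube ν a b × Cube ν a b × Cube ν a b, ℂ) where
  toFun p := pieMinor k p.1 p.2.1 p.2.2 ϰ / pieDet k p.2.2 ϰ
  continuous_toFun := (continuous_pieMinor k ϰ).div
    ((continuous_pieDet k ϰ).comp (continuous_snd.comp continuous_snd)) fun p => hϰ p.2.2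

/-- The determinant depends on `y` alone, so the first Fredholm identity can be divided by it under
the integral. -/
theorem resolventKernel_eq_left {ϰ : ℂ} (hϰ : ϰ ∈ regularNumbers k) (x s y : Cube ν a b) :
    resolventKernel hϰ (x, s, y) =
      k (x, s, y) + ϰ * ∫ t, k (x, t, y) * resolventKernel hϰ (t, s, y) := by
  have hD := hϰ y
  change pieMinor k x s y ϰ / pieDet k y ϰ =
    k (x, s, y) + ϰ * ∫ t, k (x, t, y) * (pieMinor k t s y ϰ / pieDet k y ϰ)
  simp only [← mul_div_assoc, integral_div]
  rw [pieMinor_eq_left k x s y]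
  field_simp

theorem resolventKernel_eq_right {ϰ : ℂ} (hϰ : ϰ ∈ regularNumbers k) (x s y : Cube ν a b) :
    resolventKernel hϰ (x, s, y) =
      k (x, s, y) + ϰ * ∫ t, resolventKernel hϰ (x, t, y) * k (t, s, y) := by
  have hD := hϰ y
  change pieMinor k x s y ϰ / pieDet k y ϰ =
    k (x, s, y) + ϰ * ∫ t, pieMinor k x t y ϰ / pieDet k y ϰ * k (t, s, y)
  simp only [div_mul_eq_mul_div, integral_div]
  rw [pieMinor_eq_right k x s y]
  field_simp

end Resolvent

/-! ### Solution of the equation at a regular number -/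

theorem theorem3 (ν : ℕ) (a b : ℝ)
    (k : C(Cube ν a b × Cube ν a b × Cube ν a b, ℂ)) (ϰ₀ : ℂ) (hϰ₀ : ϰ₀ ∈ regularNumbers k) :
    (∃ B : L2Space ν a b →L[ℂ] L2Space ν a b,
      IsPartialIntegralOperator (fun x s y => pieMinor k x s y ϰ₀ / pieDet k y ϰ₀) B ∧
      ∀ g₀ : L2Space ν a b,
        (∃! f : L2Space ν a b, f - ϰ₀ • partialIntegralOperator k f = g₀) ∧
        ∀ f : L2Space ν a b, f - ϰ₀ • partialIntegralOperator k f = g₀ →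
          f = g₀ + ϰ₀ • B g₀) ∧
    ∀ f : L2Space ν a b, f - ϰ₀ • partialIntegralOperator k f = 0 → f = 0 := by
  set T := partialIntegralOperator k
  set B := partialIntegralOperator (resolventKernel hϰ₀)
  have hTB : ∀ g, B g = T g + ϰ₀ • T (B g) := fun g => by
    have h := partialIntegralOperator_eq_add_comp (resolventKernel_eq_left hϰ₀)
    exact congrArg (fun A => A g) h
  have hBT : ∀ g, B g = T g + ϰ₀ • B (T g) := fun g => by
    have h := partialIntegralOperator_eq_add_comp (resolventKernel_eq_right hϰ₀)
    exact congrArg (fun A => A g) h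
  -- Existence: `B` is a right inverse correction, so only `hTB` is needed.
  have hsol : ∀ g, (g + ϰ₀ • B g) - ϰ₀ • T (g + ϰ₀ • B g) = g := fun g => by
    rw [map_add, map_smul]
    nth_rewrite 1 [hTB g]
    abel
  -- Uniqueness: after substituting `g = f - ϰ₀Tf`, the identity `hBT` collapses the right side to
  -- `f`.
  have huniq : ∀ g f, f - ϰ₀ • T f = g → f = g + ϰ₀ • B g := by
    rintro _ f rfl
    rw [map_sub, map_smul]
    rw [hBT f]
    rw [add_sub_cancel_right, sub_add_cancel]
  refine ⟨⟨B, isPartialIntegralOperator_partialIntegralOperator (resolventKernel hϰ₀),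
    fun g => ⟨⟨_, hsol g, fun f hf => huniq g f hf⟩, huniq g⟩⟩, fun f hf => ?_⟩
  simpa using huniq 0 f hf
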